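/- **Definitions.** Let $\mu$ be an infinite cardinal. A *$\mu$-ary language* $L$ is a set of function and relation symbols, each with an arity that is an ordinal $<\mu$; $|L|$ is the number of its symbols. An *$L$-structure* $M$ is a set $|M|$ with a function $F^M:{}^{n(F)}|M|\to|M|$ for each function symbol $F$ of arity $n(F)$ and a relation $R^M\subseteq{}^{n(R)}|M|$ for each relation symbol $R$ of arity $n(R)$. A *$\mu$-abstract class* is a class $K$ of $L$-structures, for a fixed $\mu$-ary language $L=L(K)$, with a reflexive and transitive relation $\le$ on $K$ such that $M\le N$ implies that $M$ is a submodel of $N$, and such that, if $f:N\to N'$ is an $L$-isomorphism and $N\in K$, then $N'\in K$, and if moreover $M\le N$, then $f(M)\in K$ and $f(M)\le N'$. A *$\mu$-directed system* in $K$ is a family $(M_i)_{i\in I}$ in $K$, where $I$ is a partially ordered set in which every subset of size $<\mu$ has an upper bound, with $M_i\le M_j$ for $i<j$. A $\mu$-abstract class $K$ is a *$\mu$-AEC* if $\mu$ is regular and 1. if $M_0\le M_2$, $M_1\le M_2$ and $M_0\subseteq M_1$, then $M_0\le M_1$; 2. if $(M_i)_{i\in I}$ is a $\mu$-directed system, then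 $\bigcup_i M_i\in K$ and $M_j\le\bigcup_i M_i$ for all $j\in I$; and if $N\in K$ satisfies $M_i\le N$ for all $i\in I$, then $\bigcup_i M_i\le N$; 3. there is a cardinal $\lambda=\lambda^{<\mu}\ge|L|+\mu$ such that for all $M\in K$ and $A\subseteq|M|$ there is $N\le M$ with $A\subseteq|N|$ and $|N|$ of cardinality at most $|A|^{<\mu}+\lambda$. The least such $\lambda$ is denoted $\mathrm{LS}(K)$. A *$K$-embedding* $f:N\to N'$ is an isomorphism of $N$ onto some $f(N)\le N'$. Consider triples $(\mathbf b,A,N)$ with $N\in K$, $A\subseteq|N|$ and $\mathbf b$ a sequence of elements of $N$. Two triples $(\mathbf b_1,A,N_1)$ and $(\mathbf b_2,A,N_2)$ are $E_{\mathrm{at}}$-related if there are $N\in K$ and $K$-embeddings $f_\ell:N_\ell\to N$ fixing $A$ pointwise with $f_1(\mathbf b_1)=f_2(\mathbf b_2)$. The *Galois type* $\mathrm{gtp}(\mathbf b/A;N)$ is the class of $(\mathbf b,A,N)$ under the transitive closure of $E_{\mathrm{at}}$. For $M\in K$ and an ordinal $\alpha$, $\mathrm{gS}^\alpha(M)$ is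 the class of all types $\mathrm{gtp}(\mathbf b/M;N)$ with $M\le N$ and $\mathbf b\in{}^\alpha|N|$. For $p=\mathrm{gtp}(\mathbf b/M;N)$, $I\subseteq\alpha$ and $A\subseteq|M|$, put $p^I\upharpoonright A=\mathrm{gtp}(\mathbf b\upharpoonright I/A;N)$. For an infinite cardinal $\kappa$, $K$ is *fully $(<\kappa)$-tame and short* if for all $M\in K$, all ordinals $\alpha$ and all distinct $p,q\in\mathrm{gS}^\alpha(M)$ there are $I\subseteq\alpha$ and $A\subseteq|M|$ with $|I|+|A|<\kappa$ and $p^I\upharpoonright A\ne q^I\upharpoonright A$. $K$ is *fully tame and short* if it is fully $(<\kappa)$-tame and short for some infinite cardinal $\kappa$. An uncountable limit cardinal $\kappa$ is *almost strongly compact* if for every cardinal $\nu<\kappa$, every $\kappa$-complete proper filter on a set extends to a $\nu$-complete ultrafilter (a filter is $\kappa$-complete if it is closed under intersections of fewer than $\kappa$ of its members). **Theorem.** Let $K$ be a $\mu$-AEC and let $\kappa>\mathrm{LS}(K)$ be an almost strongly compact cardinal. Then $K$ is fully $(<\kappa)$-tame and short. In particular, if there is a proper class of almost strongly compact cardinals,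 then for every $\mu$, every $\mu$-AEC is fully tame and short. -/

import Mathlib

universe u

namespace MuAECs

open Cardinal

/-- A `μ`-ary language: sets of function and relation symbols, each with an ordinal arity
below `μ`. -/
structure MuLanguage (μ : Cardinal.{u}) : Type (u + 1) where
  Fn : Type u
  Rel : Type u
  fnArity : Fn → Ordinal.{u}
  relArity : Rel → Ordinal.{u}
  fnArity_lt : ∀ F, fnArity F < μ.ord
  relArity_lt : ∀ R, relArity R < μ.ord

/-- The number of symbols of a language. -/
def MuLanguage.card {μ : Cardinal.{u}} (L : MuLanguage μ) : Cardinal.{u} := #L.Fn + #L.Rel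

variable {μ : Cardinal.{u}}

/-- An `L`-structure. A tuple of length `n` (an ordinal) is a function on `n.ToType`. -/
structure Str (L : MuLanguage μ) : Type (u + 1) where
  carrier : Type u
  fn : ∀ F : L.Fn, ((L.fnArity F).ToType → carrier) → carrier
  rel : ∀ R : L.Rel, ((L.relArity R).ToType → carrier) → Prop

instance {L : MuLanguage μ} : CoeSort (Str L) (Type u) := ⟨Str.carrier⟩

variable {L : MuLanguage μ}

/-- A subset of the universe of `N` closed under the functions of `N`; the same thing as a
submodel of `N`. -/
structure Substr (N : Str L) : Type u where
  carrier : Set N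
  fn_mem : ∀ (F : L.Fn) (x : (L.fnArity F).ToType → N), (∀ i, x i ∈ carrier) →
    N.fn F x ∈ carrier

namespace Substr

/-- A submodel, seen as an `L`-structure with the induced functions and relations. -/
def toStr {N : Str L} (S : Substr N) : Str L where
  carrier := S.carrier
  fn F x := ⟨N.fn F (fun i => (x i : N)), S.fn_mem F _ (fun i => (x i).2)⟩
  rel R x := N.rel R (fun i => (x i : N))

/-- The whole of `N`, as a submodel of `N`. -/
def whole (N : Str L) : Substr N := ⟨Set.univ, fun _ _ _ => trivial⟩

/-- For submodels `S` and `T` of `N` with `S ⊆ T`: `S`, seen as a submodel of `T`. -/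
def restrict {N : Str L} (S T : Substr N) : Substr T.toStr where
  carrier := {x : T.carrier | (x : N) ∈ S.carrier}
  fn_mem F _ hx := S.fn_mem F _ hx

end Substr

/-- A substructure embedding: an injective map which commutes with the functions and both
preserves and reflects the relations. -/
structure Emb (M N : Str L) : Type u where
  toFun : M → N
  inj : Function.Injective toFun
  map_fn : ∀ (F : L.Fn) (x : (L.fnArity F).ToType → M),
    toFun (M.fn F x) = N.fn F (fun i => toFun (x i))
  map_rel : ∀ (R : L.Rel) (x : (L.relArity R).ToType → M),
    N.rel R (fun i => toFun (x i)) ↔ M.rel R x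

namespace Emb

/-- The image `f(S)` of a submodel `S` of `M` under an embedding `f : M → N`. -/
def map {M N : Str L} (f : Emb M N) (S : Substr M) : Substr N where
  carrier := f.toFun '' S.carrier
  fn_mem F x hx := by
    choose y hy hyx using hx
    obtain rfl : (fun i => f.toFun (y i)) = x := funext hyx
    exact ⟨M.fn F y, S.fn_mem F y hy, f.map_fn F y⟩

/-- The image `f(M)`, a submodel of `N`. -/
def range {M N : Str L} (f : Emb M N) : Substr N := f.map (Substr.whole M)

/-- An `L`-isomorphism is a surjective substructure embedding. -/
def IsIso {M N : Str L} (f : Emb M N) : Prop := Function.Surjective f.toFun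

end Emb

/-- A `μ`-abstract class: a class `K` of `L`-structures together with a relation `M ≤ N` on `K`
which refines "`M` is a submodel of `N`". Accordingly the relation is given by saying
which submodels `S` of a structure `N` satisfy `S ≤ N`. -/
structure AbstractClass (L : MuLanguage μ) : Type (u + 1) where
  Mem : Str L → Prop
  Le : ∀ N : Str L, Substr N → Prop
  mem_of_le : ∀ {N : Str L} {S : Substr N}, Le N S → Mem S.toStr ∧ Mem N
  refl : ∀ {N : Str L}, Mem N → Le N (Substr.whole N)
  trans : ∀ {N : Str L} {S T : Substr N}, S.carrier ⊆ T.carrier →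
    Le T.toStr (S.restrict T) → Le N T → Le N S
  iso_mem : ∀ {N N' : Str L} (f : Emb N N'), f.IsIso → Mem N → Mem N'
  iso_le : ∀ {N N' : Str L} (f : Emb N N'), f.IsIso → ∀ S : Substr N, Le N S → Le N' (f.map S)

/-- A partial order in which every subset of cardinality less than `μ` has an upper bound. -/
def MuDirected (μ : Cardinal.{u}) (I : Type u) [PartialOrder I] : Prop :=
  ∀ J : Set I, #J < μ → ∃ r, ∀ s ∈ J, s ≤ r

namespace AbstractClass

variable (K : AbstractClass L)

/-- `S ≤ T` in `K`, for submodels `S` and `T` of a structure `N`. -/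
def SubLe {N : Str L} (S T : Substr N) : Prop :=
  S.carrier ⊆ T.carrier ∧ K.Le T.toStr (S.restrict T)

/-- A `μ`-directed system of models of `K`, all of them submodels of an `L`-structure `N`
(which need not be in `K`). -/
structure IsDirectedSystem {N : Str L} {I : Type u} [PartialOrder I] (S : I → Substr N) :
    Prop where
  directed : MuDirected μ I
  mem : ∀ i, K.Mem (S i).toStr
  le : ∀ i j, i < j → K.SubLe (S i) (S j)

/-- The property of a cardinal `l` in the Löwenheim-Skolem-Tarski axiom;
`a ^< μ` is the supremum of the powers `a ^ ν` with `ν < μ`. -/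
def IsLSTNumber (l : Cardinal.{u}) : Prop :=
  l = l ^< μ ∧ L.card + μ ≤ l ∧
    ∀ M : Str L, K.Mem M → ∀ A : Set M, ∃ S : Substr M,
      K.Le M S ∧ A ⊆ S.carrier ∧ #S.carrier ≤ (#A) ^< μ + l

/-- The Löwenheim-Skolem number: the least cardinal as in the
Löwenheim-Skolem-Tarski axiom. -/
noncomputable def LS : Cardinal.{u} := sInf {l | K.IsLSTNumber l}

/-- `K` is a `μ`-abstract elementary class. In the chain axioms a directed system with union `U`
is the same as a directed system of submodels of `U` which cover `U`. -/
structure IsMuAEC : Prop where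
  regular : μ.IsRegular
  coherence : ∀ {M₂ : Str L} (M₀ M₁ : Substr M₂), K.Le M₂ M₀ → K.Le M₂ M₁ →
    M₀.carrier ⊆ M₁.carrier → K.SubLe M₀ M₁
  union_mem : ∀ {U : Str L} {I : Type u} [PartialOrder I] (M : I → Substr U),
    K.IsDirectedSystem M → (⋃ i, (M i).carrier) = Set.univ →
      K.Mem U ∧ ∀ j, K.Le U (M j)
  union_le : ∀ {N : Str L} {I : Type u} [PartialOrder I] (M : I → Substr N),
    K.IsDirectedSystem M → K.Mem N → (∀ i, K.Le N (M i)) →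
      ∀ U : Substr N, U.carrier = (⋃ i, (M i).carrier) → K.Le N U
  exists_lst : ∃ l, K.IsLSTNumber l

/-- A `K`-embedding `f : M → N`: an embedding with `f(M) ≤ N`. -/
def IsKEmb {M N : Str L} (f : Emb M N) : Prop := K.Le N f.range

/-- The triples `(b, A, N)` which define Galois types over sets: a model `N` in `K`, the set `A`
included in `N` (via an injection), and a sequence `b` in `N` indexed by `ι`. -/
structure Triple (ι A : Type u) : Type (u + 1) where
  N : Str L
  mem : K.Mem N
  base : A → N
  base_inj : Function.Injective base
  seq : ι → N

/-- The relation `E_at` on triples: there are `K`-embeddings of the two models into a common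
model of `K` which agree on `A` and on the sequences. -/
def AtEquiv {ι A : Type u} (s t : K.Triple ι A) : Prop :=
  ∃ (N : Str L) (f : Emb s.N N) (g : Emb t.N N), K.Mem N ∧ K.IsKEmb f ∧ K.IsKEmb g ∧
    (∀ a, f.toFun (s.base a) = g.toFun (t.base a)) ∧
    ∀ i, f.toFun (s.seq i) = g.toFun (t.seq i)

/-- Galois types over `A` of sequences indexed by `ι`: the classes of triples modulo the
equivalence relation generated by `E_at` (which, `E_at` being reflexive and symmetric, is
its transitive closure). -/
def GaloisType (ι A : Type u) : Type (u + 1) := Quot (K.AtEquiv (ι := ι) (A := A))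

/-- `gtp(b / A; N)`. -/
def gtp {ι A : Type u} (t : K.Triple ι A) : K.GaloisType ι A := Quot.mk _ t

variable {K}

/-- Restriction of a triple to a subsequence and a smaller set. -/
def Triple.restrict {ι A : Type u} (t : K.Triple ι A) (I : Set ι) (B : Set A) :
    K.Triple I B where
  N := t.N
  mem := t.mem
  base b := t.base b
  base_inj := t.base_inj.comp Subtype.val_injective
  seq i := t.seq i

/-- The type `p^I ↾ B`: if `p = gtp(b / A; N)`, it is `gtp(b ↾ I / B; N)`. -/
def GaloisType.restrict {ι A : Type u} (p : K.GaloisType ι A) (I : Set ι) (B : Set A) :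
    K.GaloisType I B :=
  Quot.map (fun t : K.Triple ι A => t.restrict I B)
    (by
      rintro s t ⟨N, f, g, hN, hf, hg, hb, hs⟩
      exact ⟨N, f, g, hN, hf, hg, fun a => hb a, fun i => hs i⟩) p

variable (K)

/-- `gS^α(M)`: the types `gtp(b / M; N)` with `M ≤ N` (up to renaming the elements
of `M`) and `b` a sequence of length `α` in `N`. -/
def gS (α : Ordinal.{u}) (M : Str L) : Set (K.GaloisType α.ToType M) :=
  {p | ∃ (N : Str L) (hN : K.Mem N) (f : Emb M N) (b : α.ToType → N), K.IsKEmb f ∧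
    p = K.gtp ⟨N, hN, f.toFun, f.inj, b⟩}

/-- `K` is fully `(<κ)`-tame and short. -/
def FullyTameAndShortBelow (κ : Cardinal.{u}) : Prop :=
  ∀ M : Str L, K.Mem M → ∀ (α : Ordinal.{u}), ∀ p ∈ K.gS α M, ∀ q ∈ K.gS α M, p ≠ q →
    ∃ (I : Set α.ToType) (A : Set M), #I + #A < κ ∧ p.restrict I A ≠ q.restrict I A

/-- `K` is fully tame and short: fully `(<κ)`-tame and short for some infinite cardinal `κ`. -/
def FullyTameAndShort : Prop := ∃ κ : Cardinal.{u}, ℵ₀ ≤ κ ∧ K.FullyTameAndShortBelow κ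

end AbstractClass

/-- `κ` is an uncountable limit cardinal such that for every `ν < κ`, every `κ`-complete
(proper) filter extends to a `ν`-complete ultrafilter. Completeness is expressed by
`CardinalInterFilter F c`: `F` is closed under intersections of fewer than `c` members. -/
def AlmostStronglyCompact (κ : Cardinal.{u}) : Prop :=
  ℵ₀ < κ ∧ Order.IsSuccLimit κ ∧
    ∀ ν < κ, ∀ (I : Type u) (F : Filter I), F.NeBot → CardinalInterFilter F κ →
      ∃ U : Ultrafilter I, (U : Filter I) ≤ F ∧ CardinalInterFilter (U : Filter I) ν

end MuAECs

namespace MuAECs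

open Cardinal Filter

/-! Let `l = LS(K)`. Two types with the same small restrictions are compared along a fine,
`l⁺`-complete ultrafilter on the subsets of `ι ⊕ A` of size `< κ`. For each such subset the
restrictions are joined by a finite chain of `E_at`-steps, and completeness makes the length of
these chains constant almost everywhere. By fineness, the ultraproduct of the chains is a chain of
triples over all of `A`. Its ends live in ultrapowers of the two given models, which embed there
diagonally (`gtp_eq_of_ultrafilter`).

This needs Łoś's theorem for `≤`, obtained without formulas. A model of size at most `l` has at most
`l` atomic statements, because `l ^< μ = l`, so almost all members of a family of such models are
isomorphic to their ultraproduct (`subLe_sub_of_enum`). Any ultraproduct is the `μ`-directed union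
of the ultraproducts of small submodels, and the union axioms do the rest (`ultraproduct_le`,
`isKEmb_diagonal`).

Fine ultrafilters exist for singular `κ` too, by a detour through `κ⁺`
(`AlmostStronglyCompact.exists_fine_ultrafilter`). -/

theorem eventually_iff_eventually {J : Type u} (U : Ultrafilter J) (p : J → Prop) :
    ∀ᶠ s in (U : Filter J), (p s ↔ ∀ᶠ t in (U : Filter J), p t) := by
  rcases U.em p with h | h
  · exact h.mono fun s hs => ⟨fun _ => h, fun _ => hs⟩
  · exact h.mono fun s hs => ⟨fun h' => absurd h' hs, fun h' => absurd h' (U.eventually_not.1 h)⟩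

/-- Otherwise fewer than `c` null sets would cover a large set. This is how completeness makes a
choice of `i` depending on `s` constant almost everywhere. -/
theorem exists_eventually_of_eventually_exists {J ι : Type u} (U : Ultrafilter J)
    {c : Cardinal.{u}} [CardinalInterFilter (U : Filter J) c] (hι : #ι < c) {p : J → ι → Prop}
    (h : ∀ᶠ s in (U : Filter J), ∃ i, p s i) : ∃ i, ∀ᶠ s in (U : Filter J), p s i := by
  by_contra hcon
  push Not at hcon
  have h1 : ∀ᶠ s in (U : Filter J), ∀ i, ¬ p s i := by
    rw [eventually_cardinal_forall hι]
    exact fun i => Ultrafilter.eventually_not.2 (by simpa using hcon i)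
  obtain ⟨s, ⟨i, hi⟩, hs⟩ := (h.and h1).exists
  exact hs i hi

/-! ### Fine ultrafilters -/

/-- An ultrafilter on `P_κ(X)` is fine if it contains all the cones `{s | x ∈ s}`. -/
def IsFine {X : Type u} {κ : Cardinal.{u}} (U : Ultrafilter {s : Set X // #s < κ}) : Prop :=
  ∀ x, ∀ᶠ s in (U : Filter {s : Set X // #s < κ}), x ∈ s.1

/-- The filter on `P_κ(X)` generated by the cones over sets of size less than `κ`. -/
theorem exists_fine_filter {κ : Cardinal.{u}} (hκ : κ.IsRegular) (X : Type u) :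
    ∃ F : Filter {s : Set X // #s < κ}, F.NeBot ∧ CardinalInterFilter F κ ∧
      ∀ x, ∀ᶠ s in F, x ∈ s.1 := by
  have h2 : (2 : Cardinal) < κ := (natCast_lt_aleph0 (n := 2)).trans_le hκ.aleph0_le
  let F : Filter {s : Set X // #s < κ} := Filter.ofCardinalInter
    {B | ∃ A : {s : Set X // #s < κ}, ∀ s : {s : Set X // #s < κ}, A.1 ⊆ s.1 → s ∈ B} h2
    (by
      intro S hS hSl
      choose A hA using fun B : S => hSl B.2
      refine ⟨⟨⋃ B, (A B).1, (card_iUnion_lt_iff_forall_of_isRegular hκ hS).2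
        fun B => (A B).2⟩, fun s hs B hB => hA ⟨B, hB⟩ s ?_⟩
      exact (Set.subset_iUnion (fun B => (A B).1) ⟨B, hB⟩).trans hs)
    (fun s t ⟨A, hA⟩ hst => ⟨A, fun r hr => hst (hA r hr)⟩)
  refine ⟨F, ⟨fun h => ?_⟩, cardinalInter_ofCardinalInter _ _ _ _, fun x => ?_⟩
  · have : (∅ : Set {s : Set X // #s < κ}) ∈ F := by rw [h]; trivial
    obtain ⟨A, hA⟩ := this
    exact hA A subset_rfl
  · refine ⟨⟨{x}, ?_⟩, fun s hs => hs rfl⟩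
    rw [mk_singleton]
    exact Cardinal.one_lt_two.trans h2

/-- The cone filter is `κ'`-complete, hence `κ`-complete. Allowing `κ' > κ` serves the singular
case, where cones on `P_κ(X)` need not generate a `κ`-complete filter. -/
theorem exists_fine_ultrafilter_of_isRegular {κ κ' ν : Cardinal.{u}}
    (hκ : AlmostStronglyCompact κ) (hκ' : κ'.IsRegular) (h : κ ≤ κ') (hν : ν < κ) (X : Type u) :
    ∃ U : Ultrafilter {s : Set X // #s < κ'},
      CardinalInterFilter (U : Filter {s : Set X // #s < κ'}) ν ∧ IsFine U := by
  obtain ⟨F, hF, hFc, hx⟩ := exists_fine_filter hκ' X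
  obtain ⟨U, hU, hUc⟩ := hκ.2.2 ν hν _ F hF (CardinalInterFilter.of_cardinalInterFilter_of_le F h)
  exact ⟨U, hUc, fun x => hU (hx x)⟩

/-- An almost strongly compact cardinal, regular or not, carries fine ultrafilters of any smaller
degree of completeness. -/
theorem AlmostStronglyCompact.exists_fine_ultrafilter {κ ν : Cardinal.{u}}
    (hκ : AlmostStronglyCompact κ) (hν : ν < κ) (X : Type u) :
    ∃ U : Ultrafilter {s : Set X // #s < κ},
      CardinalInterFilter (U : Filter {s : Set X // #s < κ}) ν ∧ IsFine U := by
  by_cases hreg : κ.IsRegular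
  · exact exists_fine_ultrafilter_of_isRegular hκ hreg le_rfl hν X
  have hω : ℵ₀ ≤ κ := hκ.1.le
  obtain ⟨C, hC, hCcard⟩ := Order.exists_cof_eq κ.ord.ToType
  have hcof : #C < κ := by
    rw [hCcard]
    by_contra hcon
    refine hreg ⟨hω, ?_⟩
    simpa using! hcon
  -- This much completeness makes any function into the cofinal set `C` constant almost everywhere.
  have hm : max ν (Order.succ #C) < κ := max_lt hν (hκ.2.1.succ_lt hcof)
  -- A set of regular size above `κ` and `#X`, so that the pigeonhole below yields a fibre into
  -- which `X` embeds.
  let X' : Type u := (Order.succ (max κ #X)).out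
  have hX' : #X' = Order.succ (max κ #X) := mk_out _
  obtain ⟨V, hVc, hV⟩ := exists_fine_ultrafilter_of_isRegular hκ (isRegular_succ hω)
    (Order.le_succ κ) hm X'
  have hrank : ∀ s : {s : Set X' // #s < Order.succ κ}, Nonempty (s.1 ↪ κ.ord.ToType) := by
    intro s
    rw [← Cardinal.le_def, mk_toType, card_ord]
    exact Order.lt_succ_iff.1 s.2
  let r := fun s => (hrank s).some
  -- The rank of `x` in `s` lies below some member of `C`; completeness fixes that member for almost
  -- all `s`.
  have key : ∀ x : X', ∃ c : C,
      ∀ᶠ s in (V : Filter {s : Set X' // #s < Order.succ κ}), ∃ h : x ∈ s.1, r s ⟨x, h⟩ ≤ c := by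
    intro x
    refine exists_eventually_of_eventually_exists V
      ((Order.lt_succ _).trans_le (le_max_right ν _)) ((hV x).mono fun s hxs => ?_)
    obtain ⟨c, hc, hcs⟩ := hC (r s ⟨x, hxs⟩)
    exact ⟨⟨c, hc⟩, hxs, hcs⟩
  choose c hc using key
  obtain ⟨c₀, hc₀⟩ := infinite_pigeonhole c
    (by rw [hX']; exact hω.trans ((le_max_left _ _).trans (Order.le_succ _)))
    (by
      rw [hX', (isRegular_succ (hω.trans (le_max_left _ _))).cof_ord]
      exact hcof.trans_le ((le_max_left _ _).trans (Order.le_succ _)))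
  have hemb : Nonempty (X ↪ c ⁻¹' {c₀}) := by
    rw [← Cardinal.le_def, hc₀, hX']
    exact (le_max_right _ _).trans (Order.le_succ _)
  obtain ⟨k⟩ := hemb
  -- Keeping only the elements of rank at most `c₀` cuts `s` down to size below `κ`, and each
  -- element coming from the fibre of `c₀` is kept almost always.
  let t : {s : Set X' // #s < Order.succ κ} → {s : Set X // #s < κ} := fun s =>
    ⟨{x | ∃ h : (k x).1 ∈ s.1, r s ⟨(k x).1, h⟩ ≤ c₀}, by
      have h1 : #(Set.Iic (c₀ : κ.ord.ToType)) < κ := by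
        have := mk_Iic_lt (c₀ : κ.ord.ToType) (by simp) (by simpa using hω)
        simpa using this
      refine lt_of_le_of_lt ?_ h1
      refine mk_le_of_injective (f := fun x => ⟨r s ⟨(k x.1).1, x.2.1⟩, x.2.2⟩) ?_
      intro x y hxy
      have h2 := (r s).injective (Subtype.ext_iff.1 hxy)
      exact Subtype.ext (k.injective (Subtype.ext (Subtype.mk.inj h2)))⟩
  have : CardinalInterFilter (V : Filter {s : Set X' // #s < Order.succ κ}) ν :=
    CardinalInterFilter.of_cardinalInterFilter_of_le _ (le_max_left ν (Order.succ #C))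
  refine ⟨V.map t, ?_, fun x => ?_⟩
  · rw [Ultrafilter.coe_map]
    infer_instance
  · rw [Ultrafilter.coe_map, eventually_map]
    filter_upwards [hc (k x).1] with s hs
    obtain ⟨h, h'⟩ := hs
    have : c (k x).1 = c₀ := (k x).2
    rw [this] at h'
    exact ⟨h, h'⟩

/-! ### Ultraproducts of structures -/

section Ultraproduct

variable {μ : Cardinal.{u}} {L : MuLanguage μ} {J : Type u}

/-- The ultraproduct of a family of `L`-structures. -/
noncomputable def ultraproduct (U : Ultrafilter J) (N : J → Str L) : Str L where
  carrier := Quotient ((U : Filter J).productSetoid fun s => (N s).carrier)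
  fn F x := Quotient.mk _ fun s => (N s).fn F fun i => (x i).out s
  rel R x := ∀ᶠ s in (U : Filter J), (N s).rel R fun i => (x i).out s

namespace ultraproduct

variable {U : Ultrafilter J} {N : J → Str L}

/-- The class of an element of the product. -/
def cls (U : Ultrafilter J) {N : J → Str L} (x : ∀ s, N s) : ultraproduct U N :=
  Quotient.mk ((U : Filter J).productSetoid fun s => (N s).carrier) x

/-- A representative of an element of the ultraproduct. -/
noncomputable def out (a : ultraproduct U N) : ∀ s, N s :=
  Quotient.out (s := (U : Filter J).productSetoid fun s => (N s).carrier) a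

@[simp]
theorem cls_out (a : ultraproduct U N) : cls U (out a) = a := Quotient.out_eq _

theorem cls_eq_cls {x y : ∀ s, N s} : cls U x = cls U y ↔ ∀ᶠ s in (U : Filter J), x s = y s :=
  Quotient.eq

theorem out_cls (x : ∀ s, N s) : ∀ᶠ s in (U : Filter J), out (cls U x) s = x s :=
  cls_eq_cls.1 (cls_out _)

variable [CardinalInterFilter (U : Filter J) μ]

theorem mk_arity_lt {n : Ordinal.{u}} (h : n < μ.ord) : #n.ToType < μ := by
  rw [Cardinal.mk_toType]
  exact Cardinal.lt_ord.1 h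

/-- Arities are below `μ`, so `μ`-completeness changes all representatives of a tuple at once. Hence
the operations do not depend on the representatives chosen by `out`. -/
theorem out_cls_tuple {n : Ordinal.{u}} (h : n < μ.ord) (x : n.ToType → ∀ s, N s) :
    ∀ᶠ s in (U : Filter J), (fun i => out (cls U (x i)) s) = fun i => x i s := by
  simp only [funext_iff]
  rw [eventually_cardinal_forall (mk_arity_lt h)]
  exact fun i => out_cls (x i)

theorem fn_cls (F : L.Fn) (x : (L.fnArity F).ToType → ∀ s, N s) :
    (ultraproduct U N).fn F (fun i => cls U (x i)) = cls U fun s => (N s).fn F fun i => x i s :=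
  cls_eq_cls.2 ((out_cls_tuple (L.fnArity_lt F) x).mono fun s hs => congrArg ((N s).fn F) hs)

theorem rel_cls (R : L.Rel) (x : (L.relArity R).ToType → ∀ s, N s) :
    (ultraproduct U N).rel R (fun i => cls U (x i)) ↔
      ∀ᶠ s in (U : Filter J), (N s).rel R fun i => x i s :=
  eventually_congr ((out_cls_tuple (L.relArity_lt R) x).mono fun s hs =>
    iff_of_eq (congrArg ((N s).rel R) hs))

/-- The ultraproduct of a family of submodels, as a submodel of the ultraproduct. -/
noncomputable def sub (U : Ultrafilter J) [CardinalInterFilter (U : Filter J) μ]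
    {N : J → Str L} (S : ∀ s, Substr (N s)) : Substr (ultraproduct U N) where
  carrier := {a | ∀ᶠ s in (U : Filter J), out a s ∈ (S s).carrier}
  fn_mem F x hx := by
    have h1 : ∀ᶠ s in (U : Filter J), ∀ i, out (x i) s ∈ (S s).carrier :=
      (eventually_cardinal_forall (mk_arity_lt (L.fnArity_lt F))).2 hx
    have h2 : (ultraproduct U N).fn F x =
        cls U fun s => (N s).fn F fun i => out (x i) s := by
      rw [← fn_cls]
      simp
    rw [h2]
    filter_upwards [h1, out_cls (U := U) fun s => (N s).fn F fun i => out (x i) s] with s hs hs'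
    rw [hs']
    exact (S s).fn_mem F _ hs

theorem cls_mem_sub {S : ∀ s, Substr (N s)} {x : ∀ s, N s} :
    cls U x ∈ (sub U S).carrier ↔ ∀ᶠ s in (U : Filter J), x s ∈ (S s).carrier :=
  eventually_congr ((out_cls x).mono fun s hs => by rw [hs])

theorem sub_mono {S T : ∀ s, Substr (N s)} (h : ∀ s, (S s).carrier ⊆ (T s).carrier) :
    (sub U S).carrier ⊆ (sub U T).carrier :=
  fun _ ha => Eventually.mono ha fun s hs => h s hs

end ultraproduct

end Ultraproduct

/-! ### Ultraproducts and the relation `≤` -/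

@[ext]
theorem Substr.ext {μ : Cardinal.{u}} {L : MuLanguage μ} {N : Str L} {S T : Substr N}
    (h : S.carrier = T.carrier) : S = T := by
  cases S; cases T; cases h; rfl

instance {μ : Cardinal.{u}} {L : MuLanguage μ} {N : Str L} : PartialOrder (Substr N) :=
  PartialOrder.lift Substr.carrier fun _ _ => Substr.ext

/-- A submodel of a submodel `R` of `N`, as a submodel of `N`. -/
def Substr.ofSub {μ : Cardinal.{u}} {L : MuLanguage μ} {N : Str L} (R : Substr N)
    (S : Substr R.toStr) : Substr N where
  carrier := {x | ∃ h : x ∈ R.carrier, (⟨x, h⟩ : R.carrier) ∈ S.carrier}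
  fn_mem F x hx := ⟨R.fn_mem F x fun i => (hx i).1,
    S.fn_mem F (fun i => ⟨x i, (hx i).1⟩) fun i => (hx i).2⟩

theorem Substr.restrict_ofSub {μ : Cardinal.{u}} {L : MuLanguage μ} {N : Str L} (R : Substr N)
    (S : Substr R.toStr) : (R.ofSub S).restrict R = S :=
  Substr.ext (Set.ext fun x => ⟨fun h => h.2, fun h => ⟨x.2, h⟩⟩)

namespace AbstractClass

variable {μ : Cardinal.{u}} {L : MuLanguage μ} {K : AbstractClass L} {l : Cardinal.{u}}
  {J : Type u}

open ultraproduct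

theorem IsLSTNumber.powerlt_eq (hl : K.IsLSTNumber l) : l ^< μ = l := hl.1.symm

theorem IsLSTNumber.le (hl : K.IsLSTNumber l) : μ ≤ l := le_add_self.trans hl.2.1

theorem IsLSTNumber.aleph0_le (hl : K.IsLSTNumber l) (hμ : μ.IsRegular) : ℵ₀ ≤ l :=
  hμ.aleph0_le.trans hl.le

theorem IsLSTNumber.mk_fn_le (hl : K.IsLSTNumber l) : #L.Fn ≤ l :=
  le_self_add.trans (le_self_add.trans hl.2.1)

theorem IsLSTNumber.mk_rel_le (hl : K.IsLSTNumber l) : #L.Rel ≤ l :=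
  le_add_self.trans (le_self_add.trans hl.2.1)

theorem IsLSTNumber.mk_tuples_le (hl : K.IsLSTNumber l) {n : Ordinal.{u}} (hn : n < μ.ord)
    {Λ : Type u} (hΛ : #Λ = l) : #(n.ToType → Λ) ≤ l := by
  rw [← Cardinal.power_def, hΛ]
  exact (Cardinal.le_powerlt l (mk_arity_lt hn)).trans hl.powerlt_eq.le

/-- The Löwenheim-Skolem axiom is applied inside `R` and the result is moved to `N` by transitivity;
the bound collapses because `l ^< μ = l`. -/
theorem IsLSTNumber.exists_le (hl : K.IsLSTNumber l) (hμ : μ.IsRegular) {N : Str L}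
    {R : Substr N} (hR : K.Le N R) {A : Set N} (hA : A ⊆ R.carrier) (hAl : #A ≤ l) :
    ∃ S : Substr N, K.Le N S ∧ A ⊆ S.carrier ∧ S.carrier ⊆ R.carrier ∧ #S.carrier ≤ l := by
  obtain ⟨S, hS, hAS, hSl⟩ := hl.2.2 R.toStr (K.mem_of_le hR).1 (Subtype.val ⁻¹' A)
  refine ⟨R.ofSub S, K.trans (T := R) (fun x hx => hx.1) (by rwa [R.restrict_ofSub]) hR,
    fun x hx => ⟨hA hx, hAS (show (⟨x, hA hx⟩ : R.carrier) ∈ Subtype.val ⁻¹' A from hx)⟩,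
    fun x hx => hx.1, ?_⟩
  have h1 : #(Subtype.val ⁻¹' A : Set R.carrier) ≤ l :=
    (mk_preimage_of_injective _ _ Subtype.val_injective).trans hAl
  have h2 : #(R.ofSub S).carrier ≤ #S.carrier :=
    mk_le_of_injective (f := fun x => ⟨⟨x.1, x.2.1⟩, x.2.2⟩) fun x y h =>
      Subtype.ext (Subtype.mk.inj (Subtype.mk.inj h))
  refine h2.trans (hSl.trans ?_)
  refine Cardinal.add_le_of_le (hl.aleph0_le hμ) ?_ le_rfl
  refine le_trans ?_ hl.powerlt_eq.le
  rw [Cardinal.powerlt_le]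
  exact fun x hx => (Cardinal.power_le_power_right h1).trans (Cardinal.le_powerlt l hx)

/-- Łoś's theorem for families of small submodels: almost all of them are isomorphic to their
ultraproduct. -/
theorem subLe_sub_of_enum (hl : K.IsLSTNumber l) (U : Ultrafilter J)
    [CardinalInterFilter (U : Filter J) μ] [CardinalInterFilter (U : Filter J) (Order.succ l)]
    {N : J → Str L} {S T : ∀ s, Substr (N s)} {Λ : Type u} (hΛ : #Λ = l) (e : ∀ s, Λ → N s)
    (he : ∀ s, Set.range (e s) = (T s).carrier) (h : ∀ s, K.SubLe (S s) (T s)) :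
    K.SubLe (sub U S) (sub U T) := by
  refine ⟨sub_mono fun s => (h s).1, ?_⟩
  have hlt : ∀ {ι : Type u}, #ι ≤ l → #ι < Order.succ l := fun h => Order.lt_succ_of_le h
  -- With elements labelled by `Λ`, there are at most `l` atomic statements about `T` and its subset
  -- `S`. So a single `s` decides all of them as almost every index does.
  have h1 : ∀ᶠ s in (U : Filter J), ∀ i i', e s i = e s i' ↔
      ∀ᶠ t in (U : Filter J), e t i = e t i' := by
    simp only [eventually_cardinal_forall (hlt hΛ.le)]
    exact fun i i' => eventually_iff_eventually U _
  have h2 : ∀ᶠ s in (U : Filter J), ∀ F, ∀ x : (L.fnArity F).ToType → Λ, ∀ i,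
      (N s).fn F (fun k => e s (x k)) = e s i ↔
        ∀ᶠ t in (U : Filter J), (N t).fn F (fun k => e t (x k)) = e t i := by
    rw [eventually_cardinal_forall (hlt hl.mk_fn_le)]
    intro F
    rw [eventually_cardinal_forall (hlt (hl.mk_tuples_le (L.fnArity_lt F) hΛ))]
    intro x
    rw [eventually_cardinal_forall (hlt hΛ.le)]
    exact fun i => eventually_iff_eventually U _
  have h3 : ∀ᶠ s in (U : Filter J), ∀ R, ∀ x : (L.relArity R).ToType → Λ,
      (N s).rel R (fun k => e s (x k)) ↔
        ∀ᶠ t in (U : Filter J), (N t).rel R (fun k => e t (x k)) := by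
    rw [eventually_cardinal_forall (hlt hl.mk_rel_le)]
    intro R
    rw [eventually_cardinal_forall (hlt (hl.mk_tuples_le (L.relArity_lt R) hΛ))]
    exact fun x => eventually_iff_eventually U _
  have h4 : ∀ᶠ s in (U : Filter J), ∀ i, e s i ∈ (S s).carrier ↔
      ∀ᶠ t in (U : Filter J), e t i ∈ (S t).carrier := by
    rw [eventually_cardinal_forall (hlt hΛ.le)]
    exact fun i => eventually_iff_eventually U _
  obtain ⟨s, ⟨h1, h2⟩, h3, h4⟩ := ((h1.and h2).and (h3.and h4)).exists
  let E : Λ → ultraproduct U N := fun i => cls U fun t => e t i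
  have hE : ∀ i, E i ∈ (sub U T).carrier := fun i =>
    cls_mem_sub.2 (Eventually.of_forall fun t => he t ▸ Set.mem_range_self i)
  -- An element selects a label at each index, and this label is constant almost everywhere.
  have hEs : ∀ a ∈ (sub U T).carrier, ∃ i, E i = a := by
    intro a ha
    have : ∀ᶠ t in (U : Filter J), ∃ i, e t i = out a t :=
      Eventually.mono ha fun t ht => by
        rw [← he t] at ht
        exact ht
    obtain ⟨i, hi⟩ := exists_eventually_of_eventually_exists U (hlt hΛ.le) this
    exact ⟨i, by rw [← cls_out a]; exact cls_eq_cls.2 hi⟩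
  let incl : (T s).toStr → N s := fun t => t.1
  have hidx : ∀ t : (T s).toStr, ∃ i, e s i = incl t := fun t =>
    (he s).symm.subset t.2
  choose idx hidx using hidx
  -- Labels may repeat, but `h1` makes the choice of `idx` immaterial. This `g` carries the pair `S
  -- s ≤ T s` onto the pair of ultraproducts.
  let g : Emb (T s).toStr (sub U T).toStr :=
    { toFun := fun t => ⟨E (idx t), hE _⟩
      inj := by
        intro t t' htt
        have := (h1 _ _).2 (cls_eq_cls.1 (Subtype.mk.inj htt))
        rw [hidx, hidx] at this
        exact Subtype.ext this
      map_fn := by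
        intro F x
        refine Subtype.ext ?_
        refine Eq.trans ?_ (fn_cls F fun k t => e t (idx (x k))).symm
        refine (cls_eq_cls.2 ((h2 F (fun k => idx (x k)) _).1 ?_)).symm
        rw [hidx]
        simp only [hidx]
        rfl
      map_rel := by
        intro R x
        refine (rel_cls R fun k t => e t (idx (x k))).trans ?_
        rw [← h3 R fun k => idx (x k)]
        simp only [hidx]
        rfl }
  have hgi : ∀ i, g.toFun ⟨e s i, he s ▸ Set.mem_range_self i⟩ = ⟨E i, hE i⟩ := fun i =>
    Subtype.ext (cls_eq_cls.2 ((h1 _ _).1 (hidx _)))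
  have hg : g.IsIso := by
    rintro ⟨a, ha⟩
    obtain ⟨i, rfl⟩ := hEs a ha
    exact ⟨_, hgi i⟩
  have hgm : g.map ((S s).restrict (T s)) = (sub U S).restrict (sub U T) := by
    refine Substr.ext (Set.ext fun b => ⟨?_, fun hb => ?_⟩)
    · rintro ⟨t, ht, rfl⟩
      refine cls_mem_sub.2 ((h4 _).1 ?_)
      rw [hidx]
      exact ht
    · obtain ⟨a, ha⟩ := b
      obtain ⟨i, rfl⟩ := hEs a ha
      exact ⟨_, (h4 i).2 (cls_mem_sub.1 hb), hgi i⟩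
  rw [← hgm]
  exact K.iso_le g hg _ (h s).2

/-- The nonempty `K`-submodels of `N` of size at most `l` which are included in `R`. -/
abbrev Small (K : AbstractClass L) (l : Cardinal.{u}) {N : Str L} (R : Substr N) : Type u :=
  {S : Substr N // K.Le N S ∧ S.carrier ⊆ R.carrier ∧ S.carrier.Nonempty ∧ #S.carrier ≤ l}

theorem IsLSTNumber.exists_small (hl : K.IsLSTNumber l) (hμ : μ.IsRegular) {N : Str L}
    {R : Substr N} (hR : K.Le N R) (hRn : R.carrier.Nonempty) {A : Set N} (hA : A ⊆ R.carrier)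
    (hAl : #A ≤ l) : ∃ S : K.Small l R, A ⊆ S.1.carrier := by
  obtain ⟨x, hx⟩ := hRn
  -- The point `x` keeps `S` nonempty even if `A` is empty; only nonempty models can be enumerated
  -- by `Λ`.
  obtain ⟨S, h1, h2, h3, h4⟩ := hl.exists_le hμ hR (Set.insert_subset hx hA)
    (mk_insert_le.trans (add_le_of_le (hl.aleph0_le hμ) hAl
      (one_le_aleph0.trans (hl.aleph0_le hμ))))
  exact ⟨⟨S, h1, h3, ⟨x, h2 (Set.mem_insert _ _)⟩, h4⟩, (Set.subset_insert _ _).trans h2⟩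

theorem IsMuAEC.muDirected_small (hK : K.IsMuAEC) (hl : K.IsLSTNumber l) {N : Str L}
    {R : Substr N} (hR : K.Le N R) (hRn : R.carrier.Nonempty) : MuDirected μ (K.Small l R) := by
  intro D hD
  obtain ⟨r, hr⟩ := hl.exists_small hK.regular hR hRn (A := ⋃ S : D, S.1.1.carrier)
    (Set.iUnion_subset fun S => S.1.2.2.1)
    ((mk_iUnion_le _).trans ((mul_le_mul' (hD.le.trans hl.le) (ciSup_le' fun S =>
      S.1.2.2.2.2)).trans (mul_eq_self (hl.aleph0_le hK.regular)).le))
  exact ⟨r, fun S hS => (Set.subset_iUnion (fun S : D => S.1.1.carrier) ⟨S, hS⟩).trans hr⟩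

theorem IsMuAEC.exists_mem_small (hK : K.IsMuAEC) (hl : K.IsLSTNumber l) {N : Str L}
    {R : Substr N} (hR : K.Le N R) {x : N} (hx : x ∈ R.carrier) :
    ∃ S : K.Small l R, x ∈ S.1.carrier := by
  obtain ⟨S, hS⟩ := hl.exists_small hK.regular hR ⟨x, hx⟩ (Set.singleton_subset_iff.2 hx)
    ((mk_singleton _).le.trans (one_le_aleph0.trans (hl.aleph0_le hK.regular)))
  exact ⟨S, hS rfl⟩

theorem exists_range_eq {α Λ : Type u} {T : Set α} (hT : T.Nonempty) (h : #T ≤ #Λ) :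
    ∃ e : Λ → α, Set.range e = T := by
  obtain ⟨g⟩ := (Cardinal.le_def _ _).1 h
  have : Nonempty T := hT.to_subtype
  refine ⟨Subtype.val ∘ Function.invFun g, ?_⟩
  rw [(Function.invFun_surjective g.injective).range_comp, Subtype.range_coe]

variable {U : Ultrafilter J} [CardinalInterFilter (U : Filter J) μ] {N : J → Str L}
  {R : ∀ s, Substr (N s)}

/-- Each coordinate of an element lies in some small submodel; choosing one at every index gives a
member of the union. -/
theorem IsMuAEC.iUnion_sub (hK : K.IsMuAEC) (hl : K.IsLSTNumber l)
    (hR : ∀ s, K.Le (N s) (R s)) (hRn : ∀ s, (R s).carrier.Nonempty) :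
    (sub U R).carrier = ⋃ i : ∀ s, K.Small l (R s), (sub U fun s => (i s).1).carrier := by
  refine Set.Subset.antisymm (fun a ha => ?_)
    (Set.iUnion_subset fun i => sub_mono fun s => (i s).2.2.1)
  have key : ∀ s, ∃ i : K.Small l (R s),
      out a s ∈ (R s).carrier → out a s ∈ i.1.carrier := fun s => by
    by_cases h : out a s ∈ (R s).carrier
    · obtain ⟨i, hi⟩ := hK.exists_mem_small hl (hR s) h
      exact ⟨i, fun _ => hi⟩
    · obtain ⟨x, hx⟩ := hRn s
      obtain ⟨i, -⟩ := hK.exists_mem_small hl (hR s) hx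
      exact ⟨i, fun h' => absurd h' h⟩
  choose i hi using key
  exact Set.mem_iUnion.2 ⟨i, Eventually.mono ha fun s hs => hi s hs⟩

theorem sub_whole : (sub U fun s => Substr.whole (N s)).carrier = Set.univ :=
  Set.eq_univ_of_forall fun _ => Eventually.of_forall fun _ => trivial

variable [CardinalInterFilter (U : Filter J) (Order.succ l)]

/-- Upper bounds are taken coordinatewise. Coherence gives `≤` in each coordinate, and Łoś's theorem
for small models transfers it. -/
theorem IsMuAEC.isDirectedSystem_sub (hK : K.IsMuAEC) (hl : K.IsLSTNumber l)
    (hR : ∀ s, K.Le (N s) (R s)) (hRn : ∀ s, (R s).carrier.Nonempty) :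
    K.IsDirectedSystem fun i : ∀ s, K.Small l (R s) => sub U fun s => (i s).1 := by
  have key : ∀ i j : ∀ s, K.Small l (R s), i ≤ j →
      K.SubLe (sub U fun s => (i s).1) (sub U fun s => (j s).1) := by
    intro i j hij
    have hΛ := Cardinal.mk_out l
    choose e he using fun s => exists_range_eq (Λ := l.out) (j s).2.2.2.1
      ((j s).2.2.2.2.trans hΛ.ge)
    exact subLe_sub_of_enum hl U hΛ e he fun s =>
      hK.coherence _ _ (i s).2.1 (j s).2.1 (hij s)
  refine ⟨fun D hD => ?_, fun i => (K.mem_of_le (key i i le_rfl).2).2, fun i j h => key i j h.le⟩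
  choose r hr using fun s => hK.muDirected_small hl (hR s) (hRn s) ((fun i => i s) '' D)
    (mk_image_le.trans_lt hD)
  exact ⟨r, fun i hi s => hr s _ ⟨i, hi, rfl⟩⟩

theorem IsMuAEC.ultraproduct_mem_and_le (hK : K.IsMuAEC) (hl : K.IsLSTNumber l)
    (hN : ∀ s, K.Mem (N s)) (hNn : ∀ s, Nonempty (N s)) :
    K.Mem (ultraproduct U N) ∧ ∀ i : ∀ s, K.Small l (Substr.whole (N s)),
      K.Le (ultraproduct U N) (sub U fun s => (i s).1) := by
  have hn : ∀ s, (Substr.whole (N s)).carrier.Nonempty := fun s =>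
    ⟨(hNn s).some, trivial⟩
  refine hK.union_mem _ (hK.isDirectedSystem_sub (U := U) hl (fun s => K.refl (hN s)) hn) ?_
  rw [← hK.iUnion_sub hl (fun s => K.refl (hN s)) hn, sub_whole]

/-- Small submodels of `R s` are small submodels of `N s`, so their ultraproducts are already `≤`
the full one; their union is `sub U R`. -/
theorem IsMuAEC.ultraproduct_le (hK : K.IsMuAEC) (hl : K.IsLSTNumber l)
    (hR : ∀ s, K.Le (N s) (R s)) (hRn : ∀ s, (R s).carrier.Nonempty) :
    K.Le (ultraproduct U N) (sub U R) := by
  obtain ⟨h1, h2⟩ := hK.ultraproduct_mem_and_le (U := U) hl (fun s => (K.mem_of_le (hR s)).2)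
    fun s => (hRn s).to_type
  exact hK.union_le _ (hK.isDirectedSystem_sub (U := U) hl hR hRn) h1
    (fun i => h2 fun s => ⟨(i s).1, (i s).2.1, fun _ _ => trivial, (i s).2.2.2⟩)
    _ (hK.iUnion_sub hl hR hRn)

end AbstractClass

/-! ### Ultraproducts of embeddings and the diagonal -/

section Embeddings

variable {μ : Cardinal.{u}} {L : MuLanguage μ} {J : Type u}

open ultraproduct

/-- The identity embedding. -/
def Emb.id (N : Str L) : Emb N N :=
  ⟨_root_.id, Function.injective_id, fun _ _ => rfl, fun _ _ => Iff.rfl⟩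

variable {U : Ultrafilter J} [CardinalInterFilter (U : Filter J) μ] {N N' : J → Str L}

/-- The ultraproduct of a family of embeddings. -/
noncomputable def Emb.ultraproduct (U : Ultrafilter J) [CardinalInterFilter (U : Filter J) μ]
    (f : ∀ s, Emb (N s) (N' s)) : Emb (ultraproduct U N) (ultraproduct U N') where
  toFun a := cls U fun s => (f s).toFun (out a s)
  inj a b h := by
    rw [← cls_out a, ← cls_out b, cls_eq_cls]
    exact (cls_eq_cls.1 h).mono fun s hs => (f s).inj hs
  map_fn F x := by
    rw [fn_cls, cls_eq_cls]
    have h : (MuAECs.ultraproduct U N).fn F x =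
        cls U fun s => (N s).fn F fun i => out (x i) s := by
      rw [← fn_cls]
      simp
    rw [h]
    filter_upwards [out_cls (U := U) fun s => (N s).fn F fun i => out (x i) s] with s hs
    rw [hs, (f s).map_fn]
  map_rel R x := by
    rw [rel_cls]
    simp only [(f _).map_rel]
    rw [← rel_cls]
    simp

theorem Emb.ultraproduct_cls (f : ∀ s, Emb (N s) (N' s)) (x : ∀ s, N s) :
    (Emb.ultraproduct U f).toFun (cls U x) = cls U fun s => (f s).toFun (x s) :=
  cls_eq_cls.2 ((out_cls x).mono fun s hs => by rw [hs])

theorem Emb.mem_range {M N : Str L} {f : Emb M N} {y : N} :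
    y ∈ f.range.carrier ↔ ∃ x, f.toFun x = y :=
  ⟨fun ⟨x, _, h⟩ => ⟨x, h⟩, fun ⟨x, h⟩ => ⟨x, trivial, h⟩⟩

theorem Emb.range_ultraproduct (f : ∀ s, Emb (N s) (N' s)) (hN : ∀ s, Nonempty (N s)) :
    (Emb.ultraproduct U f).range = sub U fun s => (f s).range := by
  refine Substr.ext (Set.ext fun y => ⟨fun hy => ?_, fun hy => ?_⟩)
  · obtain ⟨a, rfl⟩ := mem_range.1 hy
    exact cls_mem_sub.2 (Eventually.of_forall fun s => mem_range.2 ⟨_, rfl⟩)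
  · have h : ∀ s, ∃ x, out y s ∈ (f s).range.carrier → (f s).toFun x = out y s := fun s => by
      by_cases h : out y s ∈ (f s).range.carrier
      · obtain ⟨x, hx⟩ := mem_range.1 h
        exact ⟨x, fun _ => hx⟩
      · exact ⟨(hN s).some, fun h' => absurd h' h⟩
    choose x hx using h
    refine mem_range.2 ⟨cls U x, ?_⟩
    rw [ultraproduct_cls, ← cls_out y, cls_eq_cls]
    exact Eventually.mono hy fun s hs => by simpa using hx s hs

/-- The diagonal embedding into an ultrapower. -/
noncomputable def Emb.diagonal (U : Ultrafilter J) [CardinalInterFilter (U : Filter J) μ]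
    (M : Str L) : Emb M (MuAECs.ultraproduct U fun _ => M) where
  toFun x := cls U fun _ => x
  inj x y h := by
    obtain ⟨s, hs⟩ := (cls_eq_cls.1 h).exists
    exact hs
  map_fn F x := (fn_cls F fun i _ => x i).symm
  map_rel R x := (rel_cls R fun i _ => x i).trans eventually_const

end Embeddings

namespace AbstractClass

open ultraproduct

variable {μ : Cardinal.{u}} {L : MuLanguage μ} {K : AbstractClass L} {l : Cardinal.{u}}
  {J : Type u} {U : Ultrafilter J} [CardinalInterFilter (U : Filter J) μ]
  [CardinalInterFilter (U : Filter J) (Order.succ l)]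

theorem isKEmb_id {N : Str L} (hN : K.Mem N) : K.IsKEmb (Emb.id N) := by
  have : (Emb.id N).range = Substr.whole N :=
    Substr.ext (Set.eq_univ_of_forall fun x => Emb.mem_range.2 ⟨x, rfl⟩)
  rw [IsKEmb, this]
  exact K.refl hN

theorem IsMuAEC.isKEmb_ultraproduct (hK : K.IsMuAEC) (hl : K.IsLSTNumber l) {N N' : J → Str L}
    (hN : ∀ s, Nonempty (N s)) {f : ∀ s, Emb (N s) (N' s)} (hf : ∀ s, K.IsKEmb (f s)) :
    K.IsKEmb (Emb.ultraproduct U f) := by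
  rw [IsKEmb, Emb.range_ultraproduct f hN]
  exact hK.ultraproduct_le hl hf fun s => ⟨_, Emb.mem_range.2 ⟨(hN s).some, rfl⟩⟩

/-- A small submodel coincides with its ultrapower, since a function into it is constant almost
everywhere. The diagonal image of `M` is the directed union of these ultrapowers. -/
theorem IsMuAEC.isKEmb_diagonal (hK : K.IsMuAEC) (hl : K.IsLSTNumber l) {M : Str L}
    (hM : K.Mem M) (hMn : Nonempty M) : K.IsKEmb (Emb.diagonal U M) := by
  have hle : ∀ S : K.Small l (Substr.whole M),
      K.Le (ultraproduct U fun _ => M) (sub U fun _ => S.1) := fun S =>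
    hK.ultraproduct_le hl (fun _ => S.2.1) fun _ => S.2.2.2.1
  have hsub : ∀ S : K.Small l (Substr.whole M),
      (sub U fun _ => S.1).carrier = (Emb.diagonal U M).toFun '' S.1.carrier := fun S => by
    refine Set.Subset.antisymm (fun a ha => ?_) ?_
    · have h1 : ∀ᶠ s in (U : Filter J), ∃ x : S.1.carrier, out a s = x :=
        Eventually.mono ha fun s hs => ⟨⟨_, hs⟩, rfl⟩
      obtain ⟨x, hx⟩ := exists_eventually_of_eventually_exists U
        (Order.lt_succ_of_le S.2.2.2.2) h1
      refine ⟨x, x.2, ?_⟩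
      rw [← cls_out a]
      exact (cls_eq_cls.2 hx).symm
    · rintro _ ⟨x, hx, rfl⟩
      exact cls_mem_sub.2 (Eventually.of_forall fun _ => hx)
  refine hK.union_le (fun S : K.Small l (Substr.whole M) => sub U fun _ => S.1)
    ⟨hK.muDirected_small hl (K.refl hM) ⟨hMn.some, trivial⟩, fun S => (K.mem_of_le (hle S)).1,
      fun S T h => hK.coherence _ _ (hle S) (hle T) (sub_mono fun _ => h.le)⟩
    (hK.ultraproduct_mem_and_le hl (fun _ => hM) fun _ => hMn).1 hle _ ?_
  simp only [hsub]
  rw [← Set.image_iUnion]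
  refine congrArg ((Emb.diagonal U M).toFun '' ·) (Set.eq_univ_of_forall fun x => ?_).symm
  obtain ⟨S, hS⟩ := hK.exists_mem_small hl (K.refl hM) (x := x) trivial
  exact Set.mem_iUnion.2 ⟨S, hS⟩

/-! ### Ultraproducts of triples and Galois types -/

section Triples

variable {ι A : Type u} {I : J → Set ι} {B : J → Set A}

open Classical in
/-- The ultraproduct of a family of triples over subsets of `A` and `ι` which cover them. -/
noncomputable def Triple.ultraproduct (hK : K.IsMuAEC) (hl : K.IsLSTNumber l)
    (U : Ultrafilter J) [CardinalInterFilter (U : Filter J) μ]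
    [CardinalInterFilter (U : Filter J) (Order.succ l)]
    (hB : ∀ a, ∀ᶠ s in (U : Filter J), a ∈ B s)
    (t : ∀ s, K.Triple (I s) (B s)) (ht : ∀ s, Nonempty (t s).N) : K.Triple ι A where
  N := MuAECs.ultraproduct U fun s => (t s).N
  mem := (hK.ultraproduct_mem_and_le hl (fun s => (t s).mem) ht).1
  -- The default value off `B s` is harmless: by `hB` it occurs only on a null set.
  base a := cls U fun s => if h : a ∈ B s then (t s).base ⟨a, h⟩ else (ht s).some
  base_inj a b h := by
    obtain ⟨s, ⟨h1, h2⟩, h3⟩ := (((hB a).and (hB b)).and (cls_eq_cls.1 h)).exists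
    rw [dif_pos h1, dif_pos h2] at h3
    exact Subtype.mk.inj ((t s).base_inj h3)
  seq i := cls U fun s => if h : i ∈ I s then (t s).seq ⟨i, h⟩ else (ht s).some

theorem AtEquiv.refl (t : K.Triple ι A) : K.AtEquiv t t :=
  ⟨t.N, Emb.id _, Emb.id _, t.mem, isKEmb_id t.mem, isKEmb_id t.mem, fun _ => rfl, fun _ => rfl⟩

theorem AtEquiv.symm {s t : K.Triple ι A} (h : K.AtEquiv s t) : K.AtEquiv t s := by
  obtain ⟨N, f, g, hN, hf, hg, hb, hs⟩ := h
  exact ⟨N, g, f, hN, hg, hf, fun a => (hb a).symm, fun i => (hs i).symm⟩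

theorem AtEquiv.ultraproduct (hK : K.IsMuAEC) (hl : K.IsLSTNumber l)
    (hI : ∀ i, ∀ᶠ s in (U : Filter J), i ∈ I s) (hB : ∀ a, ∀ᶠ s in (U : Filter J), a ∈ B s)
    {t t' : ∀ s, K.Triple (I s) (B s)} (ht : ∀ s, Nonempty (t s).N)
    (ht' : ∀ s, Nonempty (t' s).N) (h : ∀ s, K.AtEquiv (t s) (t' s)) :
    K.AtEquiv (Triple.ultraproduct hK hl U hB t ht) (Triple.ultraproduct hK hl U hB t' ht') := by
  choose N f g hN hf hg hb hs using h
  have hNn : ∀ s, Nonempty (N s) := fun s => ⟨(f s).toFun (ht s).some⟩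
  refine ⟨MuAECs.ultraproduct U N, Emb.ultraproduct U f, Emb.ultraproduct U g,
    (hK.ultraproduct_mem_and_le hl hN hNn).1, hK.isKEmb_ultraproduct hl ht hf,
    hK.isKEmb_ultraproduct hl ht' hg, fun a => ?_, fun i => ?_⟩
  · refine (Emb.ultraproduct_cls f _).trans (Eq.trans ?_ (Emb.ultraproduct_cls g _).symm)
    refine cls_eq_cls.2 ((hB a).mono fun s has => ?_)
    rw [dif_pos has, dif_pos has, hb]
  · refine (Emb.ultraproduct_cls f _).trans (Eq.trans ?_ (Emb.ultraproduct_cls g _).symm)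
    refine cls_eq_cls.2 ((hI i).mono fun s his => ?_)
    rw [dif_pos his, dif_pos his, hs]

/-- Restricting a triple keeps its model, so the ultraproduct is an ultrapower of `t.N`. The
diagonal on one side and the identity on the other witness `E_at`. -/
theorem atEquiv_ultraproduct_restrict (hK : K.IsMuAEC) (hl : K.IsLSTNumber l)
    (hI : ∀ i, ∀ᶠ s in (U : Filter J), i ∈ I s) (hB : ∀ a, ∀ᶠ s in (U : Filter J), a ∈ B s)
    {t : K.Triple ι A} {c : ∀ s, K.Triple (I s) (B s)} (hc : ∀ s, c s = t.restrict (I s) (B s))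
    (ht : Nonempty t.N) (hcn : ∀ s, Nonempty (c s).N) :
    K.AtEquiv t (Triple.ultraproduct hK hl U hB c hcn) := by
  obtain rfl : c = fun s => t.restrict (I s) (B s) := funext hc
  have hm := (Triple.ultraproduct hK hl U hB _ hcn).mem
  refine ⟨_, Emb.diagonal U t.N, Emb.id _, hm, hK.isKEmb_diagonal hl t.mem ht, isKEmb_id hm,
    fun a => ?_, fun i => ?_⟩
  · refine cls_eq_cls.2 ((hB a).mono fun s has => ?_)
    rw [dif_pos has]
    rfl
  · refine cls_eq_cls.2 ((hI i).mono fun s his => ?_)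
    rw [dif_pos his]
    rfl

/-- Chains are indexed by all of `ℕ`, padded by reflexivity, so that chains of different lengths can
be handled as one family. -/
theorem exists_chain_of_gtp_eq {s t : K.Triple ι A} (h : K.gtp s = K.gtp t) :
    ∃ (n : ℕ) (c : ℕ → K.Triple ι A), c 0 = s ∧ c n = t ∧ ∀ k, K.AtEquiv (c k) (c (k + 1)) := by
  have h1 : Relation.ReflTransGen K.AtEquiv s t := by
    have : Std.Symm (K.AtEquiv (ι := ι) (A := A)) := ⟨fun _ _ => AtEquiv.symm⟩
    have h2 := Quot.eqvGen_exact h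
    clear h
    induction h2 with
    | rel _ _ h => exact .single h
    | refl => exact .refl
    | symm _ _ _ ih => exact Std.Symm.symm _ _ ih
    | trans _ _ _ _ _ ih1 ih2 => exact ih1.trans ih2
  clear h
  induction h1 using Relation.ReflTransGen.head_induction_on with
  | refl => exact ⟨0, fun _ => t, rfl, rfl, fun _ => AtEquiv.refl t⟩
  | @head a b hab _ ih =>
    obtain ⟨n, c, h0, hn, hc⟩ := ih
    refine ⟨n + 1, fun k => Nat.casesOn k a c, rfl, hn, fun k => ?_⟩
    cases k with
    | zero => exact (congrArg (K.AtEquiv a) h0).mpr hab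
    | succ k => exact hc k

/-- A type which is the limit of its restrictions to small sets along a fine and sufficiently
complete ultrafilter is determined by them. -/
theorem gtp_eq_of_ultrafilter (hK : K.IsMuAEC) (hl : K.IsLSTNumber l)
    (hI : ∀ i, ∀ᶠ s in (U : Filter J), i ∈ I s) (hB : ∀ a, ∀ᶠ s in (U : Filter J), a ∈ B s)
    (hne : ∀ s, (I s).Nonempty ∨ (B s).Nonempty) {t t' : K.Triple ι A} {n : ℕ}
    {c : ∀ s, ℕ → K.Triple (I s) (B s)} (h0 : ∀ s, c s 0 = t.restrict (I s) (B s))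
    (hn : ∀ s, c s n = t'.restrict (I s) (B s))
    (hc : ∀ s k, K.AtEquiv (c s k) (c s (k + 1))) : K.gtp t = K.gtp t' := by
  have hN : ∀ s, ∀ r : K.Triple (I s) (B s), Nonempty r.N := fun s r => by
    rcases hne s with ⟨i, hi⟩ | ⟨a, ha⟩
    · exact ⟨r.seq ⟨i, hi⟩⟩
    · exact ⟨r.base ⟨a, ha⟩⟩
  obtain ⟨s₀⟩ : Nonempty J := U.neBot.nonempty
  let T : ℕ → K.Triple ι A := fun k =>
    Triple.ultraproduct hK hl U hB (fun s => c s k) fun s => hN s _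
  have hT : ∀ k, K.gtp (T 0) = K.gtp (T k) := fun k => by
    induction k with
    | zero => rfl
    | succ k ih =>
      exact ih.trans (Quot.sound (AtEquiv.ultraproduct hK hl hI hB _ _ fun s => hc s k))
  have h1 : K.gtp t = K.gtp (T 0) := Quot.sound
    (atEquiv_ultraproduct_restrict hK hl hI hB h0 (hN s₀ (t.restrict _ _)) _)
  have h2 : K.gtp t' = K.gtp (T n) := Quot.sound
    (atEquiv_ultraproduct_restrict hK hl hI hB hn (hN s₀ (t'.restrict _ _)) _)
  rw [h1, h2, hT]

/-- Serves the case of empty `ι` and `A`, where no point is available to make the models nonempty.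
-/
theorem GaloisType.eq_of_restrict_univ_eq {p q : K.GaloisType ι A}
    (h : p.restrict Set.univ Set.univ = q.restrict Set.univ Set.univ) : p = q := by
  let r : K.GaloisType (Set.univ : Set ι) (Set.univ : Set A) → K.GaloisType ι A :=
    Quot.map (fun t => ⟨t.N, t.mem, fun a => t.base ⟨a, trivial⟩,
      fun a b hab => Subtype.mk.inj (t.base_inj hab), fun i => t.seq ⟨i, trivial⟩⟩)
      fun s t ⟨N, f, g, hN, hf, hg, hb, hs⟩ => ⟨N, f, g, hN, hf, hg, fun a => hb _, fun i => hs _⟩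
  have hr : ∀ p : K.GaloisType ι A, r (p.restrict Set.univ Set.univ) = p := fun p => by
    induction p using Quot.ind
    rfl
  rw [← hr p, h, hr]

end Triples

/-! ### Tameness and shortness -/

theorem IsMuAEC.isLSTNumber_LS (hK : K.IsMuAEC) : K.IsLSTNumber K.LS :=
  csInf_mem (s := {l | K.IsLSTNumber l}) hK.exists_lst

theorem IsMuAEC.eq_of_forall_restrict_eq (hK : K.IsMuAEC) {κ : Cardinal.{u}} (hκ : K.LS < κ)
    (hsc : AlmostStronglyCompact κ) {ι A : Type u} {p q : K.GaloisType ι A}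
    (h : ∀ (I : Set ι) (B : Set A), #I + #B < κ → p.restrict I B = q.restrict I B) : p = q := by
  have hω : ℵ₀ ≤ κ := hsc.1.le
  rcases isEmpty_or_nonempty (ι ⊕ A) with hX | ⟨⟨x₀⟩⟩
  · obtain ⟨hι, hA⟩ := isEmpty_sum.1 hX
    refine GaloisType.eq_of_restrict_univ_eq (h _ _ ?_)
    simpa using aleph0_pos.trans hsc.1
  have hl := hK.isLSTNumber_LS
  obtain ⟨V, hVc, hV⟩ := hsc.exists_fine_ultrafilter (hsc.2.1.succ_lt hκ) (ι ⊕ A)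
  induction p using Quot.ind with | _ t =>
  induction q using Quot.ind with | _ t' =>
  -- Inserting `x₀` everywhere ensures that all models in the chains are nonempty.
  let I : {s : Set (ι ⊕ A) // #s < κ} → Set ι := fun s => Sum.inl ⁻¹' insert x₀ s.1
  let B : {s : Set (ι ⊕ A) // #s < κ} → Set A := fun s => Sum.inr ⁻¹' insert x₀ s.1
  have hcard : ∀ s, #(I s) + #(B s) < κ := fun s => by
    have h1 : #(insert x₀ s.1 : Set (ι ⊕ A)) < κ :=
      mk_insert_le.trans_lt (add_lt_of_lt hω s.2 (one_lt_aleph0.trans hsc.1))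
    exact add_lt_of_lt hω ((mk_preimage_of_injective _ _ Sum.inl_injective).trans_lt h1)
      ((mk_preimage_of_injective _ _ Sum.inr_injective).trans_lt h1)
  choose n c h0 hn hc using fun s => exists_chain_of_gtp_eq
    (s := t.restrict (I s) (B s)) (t := t'.restrict (I s) (B s)) (h _ _ (hcard s))
  -- As `ℵ₀ ≤ LS(K)`, completeness covers countably many cases and fixes the chain length; `W` is
  -- then the trace of `V` on the indices of length `m`.
  obtain ⟨⟨m⟩, hm⟩ := exists_eventually_of_eventually_exists (ι := ULift.{u} ℕ) V
    (c := Order.succ K.LS) (p := fun s k => n s = k.down)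
    (by simpa using! Order.lt_succ_of_le (hl.aleph0_le hK.regular))
    (Eventually.of_forall fun s => ⟨⟨n s⟩, rfl⟩)
  let e : {s // n s = m} → {s : Set (ι ⊕ A) // #s < κ} := Subtype.val
  let W : Ultrafilter {s // n s = m} := V.comap (m := e) Subtype.val_injective (by
    simpa [e] using! hm)
  have hWc : CardinalInterFilter (W : Filter {s // n s = m}) (Order.succ K.LS) := by
    rw [Ultrafilter.coe_comap]
    infer_instance
  have : CardinalInterFilter (W : Filter {s // n s = m}) μ :=
    CardinalInterFilter.of_cardinalInterFilter_of_le _ (hl.le.trans (Order.le_succ _))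
  refine gtp_eq_of_ultrafilter hK hl (U := W) (I := fun s => I s.1) (B := fun s => B s.1) (n := m)
    (c := fun s => c s.1) (fun i => ?_) (fun a => ?_) (fun s => ?_) (fun s => h0 _)
    (fun s => ?_) fun s => hc _
  · exact ((hV (Sum.inl i)).comap e).mono fun s hs => Set.mem_insert_of_mem _ hs
  · exact ((hV (Sum.inr a)).comap e).mono fun s hs => Set.mem_insert_of_mem _ hs
  · rcases x₀ with i | a
    · exact Or.inl ⟨i, Set.mem_insert _ _⟩
    · exact Or.inr ⟨a, Set.mem_insert _ _⟩
  · have := hn s.1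
    rwa [s.2] at this

theorem IsMuAEC.fullyTameAndShortBelow (hK : K.IsMuAEC) {κ : Cardinal.{u}} (hκ : K.LS < κ)
    (hsc : AlmostStronglyCompact κ) : K.FullyTameAndShortBelow κ := by
  intro M _ α p _ q _ hpq
  by_contra! hcon
  exact hpq (hK.eq_of_forall_restrict_eq hκ hsc hcon)

end AbstractClass

end MuAECs

theorem theorem5p5 :
    (∀ (μ : Cardinal.{u}) (L : MuAECs.MuLanguage μ) (K : MuAECs.AbstractClass L),
      K.IsMuAEC → ∀ κ : Cardinal.{u}, K.LS < κ → MuAECs.AlmostStronglyCompact κ →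
        K.FullyTameAndShortBelow κ) ∧
    ((∀ χ : Cardinal.{u}, ∃ κ : Cardinal.{u}, χ < κ ∧ MuAECs.AlmostStronglyCompact κ) →
      ∀ (μ : Cardinal.{u}) (L : MuAECs.MuLanguage μ) (K : MuAECs.AbstractClass L),
        K.IsMuAEC → K.FullyTameAndShort) := by
  refine ⟨fun μ L K hK κ hκ hsc => hK.fullyTameAndShortBelow hκ hsc, fun h μ L K hK => ?_⟩
  obtain ⟨κ, hκ, hsc⟩ := h K.LS
  exact ⟨κ, hsc.1.le, hK.fullyTameAndShortBelow hκ hsc⟩
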